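/- For graphs $G$ and $H$ write $G\to H$ if every colouring of the edges of $G$ with two colours contains a monochromatic (not necessarily induced) copy of $H$, and let $$\hat r(H)=\min\{|E(G)| : G \text{ a finite graph with } G\to H\}$$ be the size-Ramsey number of $H$. For $n\ge 3$ let $C_n$ be the cycle on $n$ vertices, and let $C_n^k$ be its $k$-th power: the graph with vertex set $V(C_n)$ in which two distinct vertices are adjacent if and only if their distance in $C_n$ is at most $k$. Then for every integer $k\ge 2$, $$\hat r(C_n^k)=O(n)\qquad (n\to\infty),$$ where the implicit constant may depend on $k$; that is, there are constants $c=c(k)$ and $n_0=n_0(k)$ such that $\hat r(C_n^k)\le c\,n$ for all $n\ge n_0$. -/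

import Mathlib

namespace SizeRamsey

/-- The `k`-th power of a graph `H`: distinct vertices `u`, `v` are adjacent when their distance
in `H` is at most `k`. The extended distance is used, so vertices in different components
(at distance `⊤`) are never adjacent. -/
def power {V : Type*} (H : SimpleGraph V) (k : ℕ) : SimpleGraph V where
  Adj u v := u ≠ v ∧ H.edist u v ≤ k
  symm := ⟨fun u v h => ⟨h.1.symm, by rw [SimpleGraph.edist_comm]; exact h.2⟩⟩
  loopless := ⟨fun _ h => h.1 rfl⟩

/-- `G` is `q`-Ramsey for `H`: every `q`-colouring of the edges of `G` contains a monochromatic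
copy (a not necessarily induced subgraph) of `H`. -/
def Arrows {V W : Type*} (G : SimpleGraph V) (H : SimpleGraph W) (q : ℕ) : Prop :=
  ∀ c : G.EdgeLabeling (Fin q), ∃ i : Fin q, H.IsContained (c.labelGraph i)

/-- The size-Ramsey number of `H`: the least number of edges of a finite graph that is `2`-Ramsey
for `H`. It lives in `ℕ∞`, so that it would be `⊤` (and not `0`) if there were no such graph; each
finite graph is represented by an isomorphic one on some `Fin N`. -/
noncomputable def sizeRamsey {W : Type*} (H : SimpleGraph W) : ℕ∞ :=
  sInf {m : ℕ∞ | ∃ (N : ℕ) (G : SimpleGraph (Fin N)), Arrows G H 2 ∧ m = G.edgeSet.encard}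

end SizeRamsey

namespace SizeRamsey

/-! Folding the cycle puts `C_n^k` inside the `K`-th power of an `n`-vertex path, `K = 2k`, so it
suffices to arrow path powers with `O(n)` edges. The host is `blowup G K t`. Here `G` has bounded
degree and `O(n)` vertices, any two disjoint `n`-sets inside a large set `A` are joined by an edge,
and `t` is a constant Ramsey number, so the host has `O(n)` edges.

Given a colouring, each fibre over a vertex `u` contains a monochromatic clique `B u` of fixed size;
keep the vertices of `A` whose clique has the majority colour, say blue. Relate `u` and `v` if `B u`
and `B v` span a blue `K_{2K,2K}`. A path of this relation on at least `n + 2` vertices strings blue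
cliques into a blue path power (`exists_pathPower_of_cliques`). If there is none, depth-first search
yields many large, pairwise unrelated sets (`exists_separated_sets`), and expansion gives a long
path of `G` running cyclically through `K + 1` of them (`exists_cyclic_path`). Cliques at most `K`
apart on it are completely joined in the host without a blue `K_{2K,2K}`, so red is dense enough
between them for a greedy red path power (`exists_pathPower_of_no_biclique`). -/

/-! ### Cycle powers inside path powers -/

/-- Listing the cycle on `Fin n` as `0, n - 1, 1, n - 2, …` makes adjacent vertices at most `2`
apart: `foldCycle n i` is the position of `i`. -/
def foldCycle (n i : ℕ) : ℕ := if 2 * i < n then 2 * i else 2 * (n - 1 - i) + 1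

lemma foldCycle_lt {n i : ℕ} (h : i < n) : foldCycle n i < n := by
  unfold foldCycle; split_ifs <;> omega

lemma foldCycle_injOn {n i j : ℕ} (hi : i < n) (hj : j < n)
    (h : foldCycle n i = foldCycle n j) : i = j := by
  unfold foldCycle at h; split_ifs at h <;> omega

lemma foldCycle_adj {n : ℕ} {u v : Fin n} (h : (SimpleGraph.cycleGraph n).Adj u v) :
    foldCycle n u ≤ foldCycle n v + 2 ∧ foldCycle n v ≤ foldCycle n u + 2 := by
  rw [SimpleGraph.cycleGraph_adj'] at h
  have hu := u.2
  have hv := v.2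
  have key : ∀ a b : Fin n, (a - b).val = 1 → a.val = b.val + 1 ∨ (a.val = 0 ∧ b.val + 1 = n) := by
    intro a b hab
    have ha := a.2
    have hb := b.2
    rw [Fin.sub_def] at hab
    simp only at hab
    by_cases hlt : n - b.val + a.val < n
    · rw [Nat.mod_eq_of_lt hlt] at hab; omega
    · rw [Nat.mod_eq_sub_mod (by omega), Nat.mod_eq_of_lt (by omega)] at hab; omega
  unfold foldCycle
  rcases h with h | h <;> rcases key _ _ h with h | h <;> split_ifs <;> omega

lemma foldCycle_walk {n : ℕ} {u v : Fin n} (p : (SimpleGraph.cycleGraph n).Walk u v) :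
    foldCycle n u ≤ foldCycle n v + 2 * p.length ∧
      foldCycle n v ≤ foldCycle n u + 2 * p.length := by
  induction p with
  | nil => simp
  | cons h p ih =>
    have := foldCycle_adj h
    simp only [SimpleGraph.Walk.length_cons]
    omega

/-- `y 0, …, y (n - 1)` spans the `K`-th power of a path in the graph `H`. -/
def IsPathPower {V : Type*} (H : SimpleGraph V) (K n : ℕ) (y : ℕ → V) : Prop :=
  Set.InjOn y (Set.Iio n) ∧ ∀ i j, i < j → j < n → j ≤ i + K → H.Adj (y i) (y j)

/-- Each step along the cycle moves the folded position by at most `2`, so distance at most `k`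
becomes a gap of at most `2 * k`. -/
lemma IsPathPower.cyclePower_isContained {V : Type*} {H : SimpleGraph V} {k n : ℕ} {y : ℕ → V}
    (h : IsPathPower H (2 * k) n y) :
    (power (SimpleGraph.cycleGraph n) k).IsContained H := by
  refine ⟨⟨⟨fun u => y (foldCycle n u), ?_⟩, ?_⟩⟩
  · rintro u v ⟨hne, hd⟩
    obtain ⟨p, hp⟩ := SimpleGraph.exists_walk_of_edist_ne_top (ne_top_of_le_ne_top (by simp) hd)
    rw [← hp] at hd
    have hl : p.length ≤ k := by exact_mod_cast hd
    have hw := foldCycle_walk p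
    have hne' : foldCycle n u ≠ foldCycle n v := fun he =>
      hne (Fin.ext (foldCycle_injOn u.2 v.2 he))
    rcases lt_or_gt_of_ne hne' with hlt | hlt
    · exact h.2 _ _ hlt (foldCycle_lt v.2) (by omega)
    · exact (h.2 _ _ hlt (foldCycle_lt u.2) (by omega)).symm
  · intro u v huv
    exact Fin.ext (foldCycle_injOn u.2 v.2
      (h.1 (Set.mem_Iio.2 (foldCycle_lt u.2)) (Set.mem_Iio.2 (foldCycle_lt v.2)) huv))

/-! ### Ramsey's theorem for two colours -/

/-- The finite Ramsey theorem for two relations covering the pairs of distinct elements. -/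
lemma exists_ramsey_number (a b : ℕ) : ∃ t : ℕ, ∀ {V : Type} (R₀ R₁ : SimpleGraph V)
    (T : Finset V), t ≤ T.card → (∀ x ∈ T, ∀ y ∈ T, x ≠ y → R₀.Adj x y ∨ R₁.Adj x y) →
    (∃ S ⊆ T, S.card = a ∧ ∀ x ∈ S, ∀ y ∈ S, x ≠ y → R₀.Adj x y) ∨
    (∃ S ⊆ T, S.card = b ∧ ∀ x ∈ S, ∀ y ∈ S, x ≠ y → R₁.Adj x y) := by
  classical
  induction a generalizing b with
  | zero => exact ⟨0, fun _ _ _ _ _ => Or.inl ⟨∅, by simp, by simp, by simp⟩⟩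
  | succ a iha =>
    induction b with
    | zero => exact ⟨0, fun _ _ _ _ _ => Or.inr ⟨∅, by simp, by simp, by simp⟩⟩
    | succ b ihb =>
      obtain ⟨t₁, h₁⟩ := iha (b + 1)
      obtain ⟨t₂, h₂⟩ := ihb
      refine ⟨t₁ + t₂ + 1, fun {V} R₀ R₁ T hT hcov => ?_⟩
      obtain ⟨v, hv⟩ : T.Nonempty := Finset.card_pos.1 (by omega)
      have hext : ∀ (R : SimpleGraph V) (S : Finset V) (c : ℕ), S ⊆ (T.erase v).filter (R.Adj v) →
          S.card = c → (∀ x ∈ S, ∀ y ∈ S, x ≠ y → R.Adj x y) →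
          ∃ S ⊆ T, S.card = c + 1 ∧ ∀ x ∈ S, ∀ y ∈ S, x ≠ y → R.Adj x y := by
        intro R S c hS hc hR
        have hvS : v ∉ S := fun h => by simpa using hS h
        refine ⟨insert v S, ?_, by rw [Finset.card_insert_of_notMem hvS, hc], ?_⟩
        · intro x hx
          rcases Finset.mem_insert.1 hx with rfl | hx
          · exact hv
          · exact Finset.mem_of_mem_erase (Finset.mem_filter.1 (hS hx)).1
        · intro x hx y hy hxy
          rcases Finset.mem_insert.1 hx with hx | hx <;> rcases Finset.mem_insert.1 hy with hy | hy
          · exact absurd (hx.trans hy.symm) hxy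
          · exact hx ▸ (Finset.mem_filter.1 (hS hy)).2
          · exact hy ▸ (Finset.mem_filter.1 (hS hx)).2.symm
          · exact hR x hx y hy hxy
      have hcard : T.card ≤ ((T.erase v).filter (R₀.Adj v)).card +
          ((T.erase v).filter (R₁.Adj v)).card + 1 := by
        have hsub : T.erase v ⊆ (T.erase v).filter (R₀.Adj v) ∪ (T.erase v).filter (R₁.Adj v) := by
          intro x hx
          have hx' := Finset.mem_erase.1 hx
          rcases hcov v hv x hx'.2 hx'.1.symm with h | h
          · exact Finset.mem_union_left _ (Finset.mem_filter.2 ⟨hx, h⟩)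
          · exact Finset.mem_union_right _ (Finset.mem_filter.2 ⟨hx, h⟩)
        have := (Finset.card_le_card hsub).trans (Finset.card_union_le _ _)
        rw [Finset.card_erase_of_mem hv] at this
        omega
      have hsubT : ∀ R : SimpleGraph V, (T.erase v).filter (R.Adj v) ⊆ T := fun R =>
        (Finset.filter_subset _ _).trans (Finset.erase_subset _ _)
      rcases (by omega : t₁ ≤ ((T.erase v).filter (R₀.Adj v)).card ∨
          t₂ ≤ ((T.erase v).filter (R₁.Adj v)).card) with h | h
      · rcases h₁ R₀ R₁ _ h (fun x hx y hy => hcov x (hsubT _ hx) y (hsubT _ hy)) with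
          ⟨S, hS, hc, hR⟩ | ⟨S, hS, hc, hR⟩
        · exact Or.inl (hext R₀ S a hS hc hR)
        · exact Or.inr ⟨S, hS.trans (hsubT _), hc, hR⟩
      · rcases h₂ R₀ R₁ _ h (fun x hx y hy => hcov x (hsubT _ hx) y (hsubT _ hy)) with
          ⟨S, hS, hc, hR⟩ | ⟨S, hS, hc, hR⟩
        · exact Or.inl ⟨S, hS.trans (hsubT _), hc, hR⟩
        · exact Or.inr (hext R₁ S b hS hc hR)

/-! ### Depth-first search and long paths -/

/-- Depth-first search: a finite set `A` splits into finished vertices `D`, unvisited vertices `U`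
and a directed path `P`, with no arc from `D` to `U` and with `D` and `U` of equal size. -/
lemma exists_dfs_partition {α : Type*} [DecidableEq α] (R : α → α → Prop) (A : Finset α) :
    ∃ (D U : Finset α) (P : List α), P.Nodup ∧ P.IsChain R ∧ D ∪ U ∪ P.toFinset = A ∧
      Disjoint D U ∧ (∀ x ∈ D, ∀ y ∈ U, ¬ R x y) ∧ D.card = U.card ∧
      A.card = 2 * D.card + P.length := by
  -- `m` counts search steps. Each moves one vertex from `U` to `P` or from `P` to `D`, so `D.card -
  -- U.card` grows by one from `-A.card` and vanishes at `m = A.card`. The current vertex is the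
  -- head of `P`, hence the reversed relation.
  have main : ∀ m ≤ 2 * A.card, ∃ (D U : Finset α) (P : List α), P.Nodup ∧
      P.IsChain (fun a b => R b a) ∧ D ∪ U ∪ P.toFinset = A ∧ Disjoint D U ∧
      (∀ x ∈ P, x ∉ D ∧ x ∉ U) ∧ (∀ x ∈ D, ∀ y ∈ U, ¬ R x y) ∧
      D.card + A.card = U.card + m := by
    intro m
    induction m with
    | zero => exact fun _ => ⟨∅, A, [], by simp⟩
    | succ m ih =>
      intro hm
      obtain ⟨D, U, P, hnd, hch, hA, hDU, hP, hR, hc⟩ := ih (by omega)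
      have extend : ∀ u ∈ U, (u :: P).IsChain (fun a b => R b a) →
          ∃ (D U : Finset α) (P : List α), P.Nodup ∧
          P.IsChain (fun a b => R b a) ∧ D ∪ U ∪ P.toFinset = A ∧ Disjoint D U ∧
          (∀ x ∈ P, x ∉ D ∧ x ∉ U) ∧ (∀ x ∈ D, ∀ y ∈ U, ¬ R x y) ∧
          D.card + A.card = U.card + (m + 1) := by
        intro u hu hch'
        refine ⟨D, U.erase u, u :: P, List.nodup_cons.2 ⟨fun h => (hP u h).2 hu, hnd⟩, hch', ?_,
          hDU.mono_right (Finset.erase_subset _ _), ?_, ?_, ?_⟩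
        · rw [← hA]; ext x; simp only [List.toFinset_cons, Finset.mem_union, Finset.mem_erase,
            Finset.mem_insert, List.mem_toFinset]
          by_cases hx : x = u
          · subst hx; simp [hu]
          · simp [hx]
        · intro x hx
          rcases List.mem_cons.1 hx with rfl | hx
          · exact ⟨fun h => Finset.disjoint_left.1 hDU h hu, by simp⟩
          · exact ⟨(hP x hx).1, fun h => (hP x hx).2 (Finset.mem_of_mem_erase h)⟩
        · exact fun x hx y hy => hR x hx y (Finset.mem_of_mem_erase hy)
        · have := Finset.card_pos.2 ⟨u, hu⟩
          rw [Finset.card_erase_of_mem hu]; omega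
      cases P with
      | nil =>
        have hU : U.Nonempty := by
          by_contra h
          rw [Finset.not_nonempty_iff_eq_empty] at h
          subst h
          simp at hA hc
          subst hA
          omega
        obtain ⟨u, hu⟩ := hU
        exact extend u hu (by simp)
      | cons a P =>
        by_cases h : ∃ u ∈ U, R a u
        · obtain ⟨u, hu, hau⟩ := h
          exact extend u hu (by rw [List.isChain_cons_cons]; exact ⟨hau, hch⟩)
        · push Not at h
          have ha := hP a (by simp)
          refine ⟨insert a D, U, P, (List.nodup_cons.1 hnd).2, hch.tail, ?_, ?_, ?_, ?_, ?_⟩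
          · rw [← hA]; ext x; simp only [List.toFinset_cons, Finset.mem_union,
              Finset.mem_insert, List.mem_toFinset]; tauto
          · exact Finset.disjoint_insert_left.2 ⟨ha.2, hDU⟩
          · intro x hx
            have := hP x (by simp [hx])
            refine ⟨fun hxD => ?_, this.2⟩
            rcases Finset.mem_insert.1 hxD with rfl | hxD
            · exact (List.nodup_cons.1 hnd).1 hx
            · exact this.1 hxD
          · intro x hx y hy
            rcases Finset.mem_insert.1 hx with rfl | hx
            · exact h y hy
            · exact hR x hx y hy
          · rw [Finset.card_insert_of_notMem ha.1]; omega
  obtain ⟨D, U, P, hnd, hch, hA, hDU, hP, hR, hc⟩ := main A.card (by omega)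
  refine ⟨D, U, P.reverse, by simpa, by simpa [List.isChain_reverse],
    by rwa [List.toFinset_reverse], hDU, hR, by omega,
    ?_⟩
  have hd : Disjoint (D ∪ U) P.toFinset := by
    rw [Finset.disjoint_right]
    intro x hx
    have := hP x (by simpa using hx)
    simp [this.1, this.2]
  rw [← hA, Finset.card_union_of_disjoint hd, Finset.card_union_of_disjoint hDU,
    List.toFinset_card_of_nodup hnd, List.length_reverse]
  omega

/-- If a symmetric relation has no path on `l` vertices, then every large set contains `2 ^ j` large
disjoint sets that are pairwise unrelated. -/
lemma exists_separated_sets {α : Type*} [DecidableEq α] {R : α → α → Prop}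
    (hsymm : ∀ x y, R x y → R y x) {l : ℕ} {A : Finset α}
    (hpath : ∀ P : List α, P.Nodup → P.IsChain R → (∀ x ∈ P, x ∈ A) → P.length ≤ l) (s j : ℕ)
    (hA : 2 ^ j * (s + l) ≤ A.card + l) :
    ∃ W : ℕ → Finset α, (∀ i < 2 ^ j, W i ⊆ A ∧ s ≤ (W i).card) ∧
      ∀ i < 2 ^ j, ∀ i' < 2 ^ j, i ≠ i' → Disjoint (W i) (W i') ∧
        ∀ x ∈ W i, ∀ y ∈ W i', ¬ R x y := by
  induction j generalizing A with
  | zero => exact ⟨fun _ => A, fun i _ => ⟨subset_rfl, by simpa using hA⟩,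
      fun i hi i' hi' => by omega⟩
  | succ j ih =>
    obtain ⟨D, U, P, hnd, hch, hDUP, hDU, hR, hc, hcard⟩ := exists_dfs_partition R A
    have hDA : D ⊆ A := by rw [← hDUP]; intro x hx; simp [hx]
    have hUA : U ⊆ A := by rw [← hDUP]; intro x hx; simp [hx]
    have hP := hpath P hnd hch (fun x hx => by rw [← hDUP]; simp [hx])
    rw [pow_succ] at hA
    -- At most `l` vertices lie on `P` and the rest splits evenly, so passing to `D` or `U` at worst
    -- halves the quantity `card + l`.
    have hD : 2 ^ j * (s + l) ≤ D.card + l := by nlinarith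
    obtain ⟨W₁, h₁, h₁'⟩ := ih (A := D) (fun P h h' hD' => hpath P h h' fun x hx => hDA (hD' x hx)) hD
    obtain ⟨W₂, h₂, h₂'⟩ := ih (A := U) (fun P h h' hD' => hpath P h h' fun x hx => hUA (hD' x hx))
      (hc ▸ hD)
    refine ⟨fun i => if i < 2 ^ j then W₁ i else W₂ (i - 2 ^ j), fun i hi => ?_,
      fun i hi i' hi' hne => ?_⟩
    · rw [pow_succ] at hi
      dsimp only
      split_ifs with h
      · exact ⟨(h₁ i h).1.trans hDA, (h₁ i h).2⟩
      · exact ⟨(h₂ _ (by omega)).1.trans hUA, (h₂ _ (by omega)).2⟩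
    · rw [pow_succ] at hi hi'
      dsimp only
      split_ifs with h h' h'
      · exact h₁' i h i' h' hne
      · have a := (h₁ i h).1
        have b := (h₂ (i' - 2 ^ j) (by omega)).1
        exact ⟨hDU.mono a b, fun x hx y hy => hR x (a hx) y (b hy)⟩
      · have a := (h₁ i' h').1
        have b := (h₂ (i - 2 ^ j) (by omega)).1
        exact ⟨(hDU.mono a b).symm, fun x hx y hy hxy => hR y (a hy) x (b hx) (hsymm _ _ hxy)⟩
      · exact h₂' _ (by omega) _ (by omega) (by omega)

/-- In a graph where any two disjoint sets of size `M` are joined by an edge, disjoint sets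
`W 0, …, W (p - 1)` of size at least `2 M + l` carry a path on more than `l` vertices that visits
them in cyclic order. -/
lemma exists_cyclic_path {α : Type*} [DecidableEq α] {G : α → α → Prop} {M l p : ℕ} (hp : 2 ≤ p)
    {W : ℕ → Finset α}
    (hG : ∀ X Y : Finset α, X ⊆ (Finset.range p).biUnion W → Y ⊆ (Finset.range p).biUnion W →
      Disjoint X Y → M ≤ X.card → M ≤ Y.card → ∃ x ∈ X, ∃ y ∈ Y, G x y)
    (hW : ∀ i < p, 2 * M + l ≤ (W i).card)
    (hdisj : ∀ i < p, ∀ j < p, i ≠ j → Disjoint (W i) (W j)) :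
    ∃ (P : List α) (i₀ : ℕ), P.Nodup ∧ l < P.length ∧ P.IsChain G ∧
      ∀ r (hr : r < P.length), P[r] ∈ W ((i₀ + r) % p) := by
  set A := (Finset.range p).biUnion W with hAdef
  have hWA : ∀ i < p, W i ⊆ A := fun i hi =>
    Finset.subset_biUnion_of_mem W (Finset.mem_range.2 hi)
  obtain ⟨D, U, P, hnd, hch, hDUP, hDU, hR, hc, hcard⟩ :=
    -- The search uses only arcs of `G` from one class to the next. Were `P` short, a class with `M`
    -- finished vertices would force fewer than `M` unvisited ones in the next class, which then has
    -- `M` finished vertices too. Going round the cycle gives `U.card < p * M`, against `U.card =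
    -- D.card ≥ p * M`.
    exists_dfs_partition (fun x y => G x y ∧ ∃ i < p, x ∈ W i ∧ y ∈ W ((i + 1) % p)) A
  have hDA : D ⊆ A := by rw [← hDUP]; intro x hx; simp [hx]
  have hUA : U ⊆ A := by rw [← hDUP]; intro x hx; simp [hx]
  have hmod : ∀ i, i % p < p := fun i => Nat.mod_lt _ (by omega)
  have hlen : l < P.length := by
    by_contra hle
    push Not at hle
    have hstep : ∀ i < p, M ≤ (D ∩ W i).card → (U ∩ W ((i + 1) % p)).card < M := by
      intro i hi hDi
      by_contra hU
      push Not at hU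
      obtain ⟨x, hx, y, hy, hxy⟩ := hG _ _ (Finset.inter_subset_left.trans hDA)
        (Finset.inter_subset_left.trans hUA)
        (hDU.mono Finset.inter_subset_left Finset.inter_subset_left) hDi hU
      rw [Finset.mem_inter] at hx hy
      exact hR x hx.1 y hy.1 ⟨hxy, i, hi, hx.2, hy.2⟩
    have hsplit : ∀ i < p, (W i).card ≤ (D ∩ W i).card + (U ∩ W i).card + l := by
      intro i hi
      have hsub : W i ⊆ (D ∩ W i) ∪ (U ∩ W i) ∪ P.toFinset := by
        intro x hx
        have := hWA i hi hx
        rw [← hDUP] at this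
        simp only [Finset.mem_union, Finset.mem_inter] at this ⊢
        tauto
      have h1 := Finset.card_le_card hsub
      have h2 := Finset.card_union_le ((D ∩ W i) ∪ (U ∩ W i)) P.toFinset
      have h3 := Finset.card_union_le (D ∩ W i) (U ∩ W i)
      have h4 := List.toFinset_card_le P
      omega
    have hsum : ∀ X ⊆ A, X.card ≤ ∑ i ∈ Finset.range p, (X ∩ W i).card := by
      intro X hX
      refine (Finset.card_le_card ?_).trans Finset.card_biUnion_le
      intro x hx
      have := hX hx
      simp only [hAdef, Finset.mem_biUnion, Finset.mem_inter] at this ⊢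
      obtain ⟨i, hi, h⟩ := this
      exact ⟨i, hi, hx, h⟩
    have hAcard : p * (2 * M + l) ≤ A.card := by
      rw [hAdef, Finset.card_biUnion]
      · calc p * (2 * M + l) = ∑ i ∈ Finset.range p, (2 * M + l) := by simp
          _ ≤ _ := Finset.sum_le_sum fun i hi => hW i (Finset.mem_range.1 hi)
      · exact fun i hi j hj => hdisj i (Finset.mem_range.1 hi) j (Finset.mem_range.1 hj)
    have hDbig : p * M ≤ D.card := by nlinarith
    obtain ⟨i₁, hi₁, hDi₁⟩ : ∃ i < p, M ≤ (D ∩ W i).card := by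
      by_contra! hcon
      have h1 : ∑ i ∈ Finset.range p, (D ∩ W i).card < ∑ i ∈ Finset.range p, M :=
        Finset.sum_lt_sum_of_nonempty ⟨0, by simp; omega⟩ fun i hi => hcon i (Finset.mem_range.1 hi)
      have h2 := hsum D hDA
      simp at h1
      omega
    have hall : ∀ r, (U ∩ W ((i₁ + r + 1) % p)).card < M := by
      intro r
      induction r with
      | zero => exact hstep i₁ hi₁ hDi₁
      | succ r ih =>
        have h1 := hsplit _ (hmod (i₁ + r + 1))
        have h2 := hW _ (hmod (i₁ + r + 1))
        have h3 := hstep _ (hmod (i₁ + r + 1)) (by omega)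
        rwa [Nat.mod_add_mod] at h3
    have h1 : ∑ i ∈ Finset.range p, (U ∩ W i).card < ∑ i ∈ Finset.range p, M := by
      refine Finset.sum_lt_sum_of_nonempty ⟨0, by simp; omega⟩ fun i hi => ?_
      have hi := Finset.mem_range.1 hi
      have h := hall (i + (p - 1 - i₁))
      have he : i₁ + (i + (p - 1 - i₁)) + 1 = i + p := by omega
      rwa [he, Nat.add_mod_right, Nat.mod_eq_of_lt hi] at h
    have h2 := hsum U hUA
    simp at h1
    omega
  have hP0 : P[0] ∈ A := by rw [← hDUP]; simp
  obtain ⟨i₀, hi₀, h0⟩ := Finset.mem_biUnion.1 hP0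
  rw [Finset.mem_range] at hi₀
  refine ⟨P, i₀, hnd, hlen, hch.imp fun a b h => h.1, fun r => ?_⟩
  induction r with
  | zero => intro _; rwa [Nat.add_zero, Nat.mod_eq_of_lt hi₀]
  | succ r ih =>
    intro hr
    obtain ⟨-, i, hi, hx, hy⟩ := List.isChain_iff_getElem.1 hch r hr
    have hri := ih (by omega)
    have : i = (i₀ + r) % p := by
      by_contra hne
      exact Finset.disjoint_left.1 (hdisj _ hi _ (hmod _) hne) hx hri
    rwa [this, Nat.mod_add_mod] at hy

/-! ### Expanders of bounded degree -/

/-- Random maps yield expansion: some `d`-tuple of self-maps of a set of size `q * M` sends every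
set of size `M` into every other one. -/
lemma exists_expanding_maps (q : ℕ) (hq : 1 ≤ q) : ∃ d : ℕ, ∀ M : ℕ, 0 < M →
    ∃ f : Fin (q * M) × Fin d → Fin (q * M), ∀ X Y : Finset (Fin (q * M)),
      X.card = M → Y.card = M → ∃ x ∈ X, ∃ i, f (x, i) ∈ Y := by
  classical
  -- This choice makes the union bound work: there are at most `4 ^ (q * M)` pairs `(X, Y)`, and a
  -- random tuple of maps sends `X` off `Y` with probability `(1 - 1/q) ^ (M * d)`.
  obtain ⟨d, hd⟩ : ∃ d : ℕ, (q - 1) ^ d * 4 ^ q < q ^ d := by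
    obtain ⟨d, hd⟩ := exists_pow_lt_of_lt_one (x := ((4 : ℝ) ^ q)⁻¹) (y := ((q : ℝ) - 1) / q)
      (by positivity) (by rw [div_lt_one (by positivity)]; linarith)
    refine ⟨d, ?_⟩
    rw [div_pow, div_lt_iff₀ (by positivity), inv_mul_eq_div, lt_div_iff₀ (by positivity)] at hd
    have : (((q - 1 : ℕ) : ℝ)) = (q : ℝ) - 1 := by push_cast [hq]; ring
    rw [← this] at hd
    exact_mod_cast hd
  refine ⟨d, fun M hM => ?_⟩
  by_contra! hcon
  set N := q * M with hN
  let bad : Finset (Fin N) × Finset (Fin N) → Finset (Fin N × Fin d → Fin N) := fun XY =>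
    Fintype.piFinset fun p => if p.1 ∈ XY.1 then XY.2ᶜ else Finset.univ
  let pairs : Finset (Finset (Fin N) × Finset (Fin N)) :=
    Finset.univ.filter fun XY => XY.1.card = M ∧ XY.2.card = M
  have hcover : (Finset.univ : Finset (Fin N × Fin d → Fin N)) ⊆ pairs.biUnion bad := by
    intro f _
    obtain ⟨X, Y, hX, hY, h⟩ := hcon f
    refine Finset.mem_biUnion.2 ⟨(X, Y), by simp [pairs, hX, hY], ?_⟩
    simp only [bad, Fintype.mem_piFinset]
    rintro ⟨x, i⟩
    split_ifs with hx
    · simpa using h x hx i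
    · simp
  have hbad : ∀ XY ∈ pairs, (bad XY).card = (N - M) ^ (M * d) * N ^ ((N - M) * d) := by
    rintro ⟨X, Y⟩ hXY
    obtain ⟨hX, hY⟩ : X.card = M ∧ Y.card = M := by simpa [pairs] using hXY
    have hterm : ∀ x : Fin N, (if x ∈ X then Yᶜ else Finset.univ).card =
        if x ∈ X then N - M else N := by
      intro x; split_ifs <;> simp [Finset.card_compl, hY]
    simp only [bad, Fintype.card_piFinset, hterm]
    rw [Fintype.prod_prod_type_right]
    simp only [Finset.prod_const, Finset.prod_ite, Finset.card_univ, Fintype.card_fin]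
    have h1 : (Finset.univ.filter (· ∈ X)).card = M := by simp [hX]
    have h2 : (Finset.univ.filter (· ∉ X)).card = N - M := by
      rw [← Finset.compl_filter, Finset.card_compl, h1]; simp
    rw [h1, h2, mul_pow, ← pow_mul, ← pow_mul]
  have hpairs : pairs.card ≤ 4 ^ N := by
    refine (Finset.card_le_univ _).trans ?_
    simp [Fintype.card_prod, ← mul_pow]
  have h1 := (Finset.card_le_card hcover).trans Finset.card_biUnion_le
  rw [Finset.sum_congr rfl hbad, Finset.sum_const, Finset.card_univ, smul_eq_mul] at h1
  simp only [Fintype.card_fun, Fintype.card_prod, Fintype.card_fin] at h1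
  have hMN : M ≤ N := by rw [hN]; exact Nat.le_mul_of_pos_left _ hq
  have hNM : N - M = (q - 1) * M := by rw [hN, Nat.sub_mul, one_mul]
  have h2 : N ^ (M * d) ≤ 4 ^ N * (N - M) ^ (M * d) := by
    have hpos : 0 < N ^ ((N - M) * d) := by positivity
    refine Nat.le_of_mul_le_mul_right ?_ hpos
    calc N ^ (M * d) * N ^ ((N - M) * d) = N ^ (N * d) := by
          rw [← pow_add, ← add_mul, Nat.add_sub_cancel' hMN]
      _ ≤ pairs.card * ((N - M) ^ (M * d) * N ^ ((N - M) * d)) := h1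
      _ ≤ 4 ^ N * ((N - M) ^ (M * d) * N ^ ((N - M) * d)) := Nat.mul_le_mul_right _ hpairs
      _ = _ := by ring
  have h3 : (q ^ d) ^ M ≤ ((q - 1) ^ d * 4 ^ q) ^ M := by
    have hpos : 0 < M ^ (M * d) := by positivity
    refine Nat.le_of_mul_le_mul_right ?_ hpos
    calc (q ^ d) ^ M * M ^ (M * d) = N ^ (M * d) := by
          rw [hN, mul_pow, ← pow_mul, mul_comm d]
      _ ≤ _ := h2
      _ = _ := by rw [hNM, hN, mul_pow, mul_pow, ← pow_mul, ← pow_mul, mul_comm d]; ring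
  exact absurd (Nat.pow_lt_pow_left hd hM.ne') (not_lt.2 h3)

/-- Bounded degree graphs on `q * M` vertices in which any two disjoint `M`-subsets of a set `A`
containing at least half of the vertices are joined by an edge. -/
lemma exists_expander (q : ℕ) (hq : 1 ≤ q) : ∃ b : ℕ, ∀ M : ℕ, 0 < M →
    ∃ (G : SimpleGraph (Fin (q * M))) (A : Finset (Fin (q * M))), q * M ≤ 2 * A.card ∧
      (∀ v, ∃ S : Finset (Fin (q * M)), S.card ≤ b ∧ ∀ u, G.Adj v u → u ∈ S) ∧
      ∀ X Y : Finset (Fin (q * M)), X ⊆ A → Y ⊆ A → Disjoint X Y → M ≤ X.card → M ≤ Y.card →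
        ∃ x ∈ X, ∃ y ∈ Y, G.Adj x y := by
  classical
  obtain ⟨d, hd⟩ := exists_expanding_maps q hq
  -- At most `d` out-neighbours and `2 * d` in-neighbours: the mean in-degree is `d`, so discarding
  -- the vertices of in-degree above `2 * d` leaves at least half of them in `A`.
  refine ⟨d + 2 * d, fun M hM => ?_⟩
  obtain ⟨f, hf⟩ := hd M hM
  let deg : Fin (q * M) → ℕ := fun v => (Finset.univ.filter fun p => f p = v).card
  let A : Finset (Fin (q * M)) := Finset.univ.filter fun v => deg v ≤ 2 * d
  let G : SimpleGraph (Fin (q * M)) := SimpleGraph.fromRel fun u v =>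
    u ∈ A ∧ v ∈ A ∧ ∃ i, f (u, i) = v
  refine ⟨G, A, ?_, fun v => ?_, fun X Y hX hY hXY hXM hYM => ?_⟩
  · have hsum : ∑ v, deg v = q * M * d := by
      have := Finset.card_eq_sum_card_fiberwise (s := (Finset.univ : Finset (Fin (q * M) × Fin d)))
        (t := Finset.univ) (f := f) (fun _ _ => by simp)
      simpa [deg] using this.symm
    have hle : Aᶜ.card * (2 * d + 1) ≤ q * M * d := by
      rw [← hsum, ← smul_eq_mul]
      refine (Finset.card_nsmul_le_sum Aᶜ deg _ fun v hv => ?_).trans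
        (Finset.sum_le_sum_of_subset (Finset.subset_univ _))
      have : ¬ deg v ≤ 2 * d := by simpa [A] using hv
      omega
    have hcard := Finset.card_add_card_compl A
    rw [Fintype.card_fin] at hcard
    have : 2 * Aᶜ.card ≤ q * M := by
      by_contra! hlt
      nlinarith
    omega
  · by_cases hv : v ∈ A
    · refine ⟨(Finset.univ.image fun i => f (v, i)) ∪
        (Finset.univ.filter fun p => f p = v).image Prod.fst, ?_, fun u hu => ?_⟩
      · have hvd : deg v ≤ 2 * d := by simpa [A] using hv
        have h1 : (Finset.univ.image fun i => f (v, i)).card ≤ d := by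
          simpa using Finset.card_image_le (s := (Finset.univ : Finset (Fin d)))
            (f := fun i => f (v, i))
        exact (Finset.card_union_le _ _).trans (Nat.add_le_add h1 (Finset.card_image_le.trans hvd))
      · simp only [G, SimpleGraph.fromRel_adj] at hu
        simp only [Finset.mem_union, Finset.mem_image, Finset.mem_filter, Finset.mem_univ, true_and]
        rcases hu.2 with ⟨-, -, i, hi⟩ | ⟨-, -, i, hi⟩
        · exact Or.inl ⟨i, hi⟩
        · exact Or.inr ⟨(u, i), hi, rfl⟩
    · refine ⟨∅, by simp, fun u hu => ?_⟩
      simp [G, hv] at hu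
  · obtain ⟨X', hX', hXc⟩ := Finset.exists_subset_card_eq hXM
    obtain ⟨Y', hY', hYc⟩ := Finset.exists_subset_card_eq hYM
    obtain ⟨x, hx, i, hi⟩ := hf X' Y' hXc hYc
    refine ⟨x, hX' hx, f (x, i), hY' hi, ?_⟩
    simp only [G, SimpleGraph.fromRel_adj]
    refine ⟨fun h => ?_, Or.inl ⟨hX (hX' hx), hY (hY' hi), i, rfl⟩⟩
    exact Finset.disjoint_left.1 hXY (hX' hx) (h ▸ hY' hi)

/-! ### The host graph and its number of edges -/

lemma exists_ball_cover {V : Type*} (G : SimpleGraph V) {b : ℕ}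
    (hb : ∀ v, ∃ S : Finset V, S.card ≤ b ∧ ∀ u, G.Adj v u → u ∈ S) (K : ℕ) (u : V) :
    ∃ B : Finset V, B.card ≤ (b + 1) ^ K ∧ ∀ v (p : G.Walk u v), p.length ≤ K → v ∈ B := by
  classical
  induction K generalizing u with
  | zero =>
    refine ⟨{u}, by simp, fun v p hp => ?_⟩
    rw [SimpleGraph.Walk.eq_of_length_eq_zero (Nat.le_zero.1 hp)]
    simp
  | succ K ih =>
    choose B hB hmem using ih
    obtain ⟨S, hS, hadj⟩ := hb u
    refine ⟨B u ∪ S.biUnion B, ?_, fun v p hp => ?_⟩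
    · calc (B u ∪ S.biUnion B).card ≤ (B u).card + (S.biUnion B).card := Finset.card_union_le _ _
        _ ≤ (b + 1) ^ K + S.card * (b + 1) ^ K :=
          Nat.add_le_add (hB u) (Finset.card_biUnion_le_card_mul _ _ _ fun w _ => hB w)
        _ ≤ (b + 1) ^ K + b * (b + 1) ^ K :=
          Nat.add_le_add_left (Nat.mul_le_mul_right _ hS) _
        _ = (b + 1) ^ (K + 1) := by ring
    · cases p with
      | nil => exact Finset.mem_union_left _ (hmem u u .nil (by simp))
      | cons h p =>
        rw [SimpleGraph.Walk.length_cons] at hp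
        exact Finset.mem_union_right _
          (Finset.mem_biUnion.2 ⟨_, hadj _ h, hmem _ _ p (by omega)⟩)

/-- The strong product of the `K`-th power of `G` with a complete graph on `t` vertices. -/
def blowup {V : Type*} (G : SimpleGraph V) (K t : ℕ) : SimpleGraph (V × Fin t) where
  Adj x y := x ≠ y ∧ G.edist x.1 y.1 ≤ K
  symm := ⟨fun x y h => ⟨h.1.symm, by rw [SimpleGraph.edist_comm]; exact h.2⟩⟩
  loopless := ⟨fun _ h => h.1 rfl⟩

/-- With `b`, `K` and `t` constant this is linear in the order of `G`: each of the `t * Fintype.card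
V` vertices has at most `(b + 1) ^ K * t` neighbours. -/
lemma encard_edgeSet_blowup_le {V : Type*} [Fintype V] {b : ℕ} (G : SimpleGraph V)
    (hb : ∀ v, ∃ S : Finset V, S.card ≤ b ∧ ∀ u, G.Adj v u → u ∈ S) (K t : ℕ) :
    (blowup G K t).edgeSet.encard ≤ (((b + 1) ^ K * t * t * Fintype.card V : ℕ) : ℕ∞) := by
  classical
  choose B hB hmem using exists_ball_cover G hb K
  let E : Finset (Sym2 (V × Fin t)) := Finset.univ.biUnion fun x : V × Fin t =>
    (B x.1 ×ˢ (Finset.univ : Finset (Fin t))).image fun y => s(x, y)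
  have hsub : (blowup G K t).edgeSet ⊆ E := by
    intro e
    induction e using Sym2.inductionOn with
    | _ x y =>
      rintro ⟨-, hd⟩
      obtain ⟨p, hp⟩ := SimpleGraph.exists_walk_of_edist_ne_top (ne_top_of_le_ne_top (by simp) hd)
      rw [← hp] at hd
      have hy := hmem x.1 y.1 p (by exact_mod_cast hd)
      exact Finset.mem_biUnion.2 ⟨x, by simp, Finset.mem_image.2 ⟨y, by simp [hy], rfl⟩⟩
  refine (Set.encard_le_encard hsub).trans ?_
  rw [Set.encard_coe_eq_coe_finsetCard]
  norm_cast
  have hE : E.card ≤ (Finset.univ : Finset (V × Fin t)).card * ((b + 1) ^ K * t) := by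
    refine Finset.card_biUnion_le_card_mul _ _ _ fun x _ => Finset.card_image_le.trans ?_
    rw [Finset.card_product, Finset.card_univ, Fintype.card_fin]
    exact Nat.mul_le_mul_right _ (hB x.1)
  rw [Finset.card_univ, Fintype.card_prod, Fintype.card_fin] at hE
  exact hE.trans_eq (by ring)

lemma sizeRamsey_le_of_arrows {V W : Type*} [Fintype V] {G : SimpleGraph V} {H : SimpleGraph W}
    (h : Arrows G H 2) : sizeRamsey H ≤ G.edgeSet.encard := by
  let φ := G.overFinIso rfl
  refine sInf_le ⟨_, G.overFin rfl, fun c => ?_, Set.encard_congr φ.mapEdgeSet⟩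
  obtain ⟨i, hi⟩ := h (c.pullback φ.toHom)
  refine ⟨i, hi.trans ⟨⟨⟨φ, fun {x y} hxy => ?_⟩, φ.injective⟩⟩⟩
  rw [SimpleGraph.EdgeLabeling.labelGraph_adj] at hxy ⊢
  obtain ⟨hG, hc⟩ := hxy
  exact ⟨φ.map_adj_iff.2 hG, hc⟩

/-! ### Finding path powers in one colour -/

/-- Greedy embedding: if each vertex set `B i` is large and no two of them at distance at most `K`
span a blue `K_{m,m}`, then one can choose a red path power with one vertex in each `B i`. -/
lemma exists_pathPower_of_no_biclique {V : Type*} {red blue : SimpleGraph V} {K m n : ℕ}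
    (hK : 0 < K) (hm : 0 < m) (hn : 0 < n) {B : ℕ → Finset V}
    (hdisj : ∀ i < n, ∀ j < n, i ≠ j → Disjoint (B i) (B j))
    (hcard : ∀ j < n, K * m * (2 * m) ^ K ≤ (B j).card)
    (hcov : ∀ i j, i < j → j < n → j ≤ i + K → ∀ x ∈ B i, ∀ y ∈ B j, red.Adj x y ∨ blue.Adj x y)
    (hno : ∀ i j, i < j → j < n → j ≤ i + K → ∀ X ⊆ B i, ∀ Y ⊆ B j, X.card = m → Y.card = m →
      ∃ x ∈ X, ∃ y ∈ Y, ¬ blue.Adj x y) :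
    ∃ y, IsPathPower red K n y := by
  classical
  -- `S j` holds the candidates still available for position `j`. It shrinks by a factor of at most
  -- `2 * m` for each of the `K` positions before `j`, leaving `K * m` candidates when its turn
  -- comes.
  have main : ∀ r ≤ n, ∃ (y : ℕ → V) (S : ℕ → Finset V), (∀ i < r, y i ∈ B i) ∧
      (∀ i j, i < j → j < r → j ≤ i + K → red.Adj (y i) (y j)) ∧
      ∀ j, r ≤ j → j < n → S j ⊆ B j ∧ K * m * (2 * m) ^ min (j - r) K ≤ (S j).card ∧
        ∀ i < r, j ≤ i + K → ∀ v ∈ S j, red.Adj (y i) v := by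
    intro r
    induction r with
    | zero =>
      intro _
      have hpos : 0 < (B 0).card := lt_of_lt_of_le (by positivity) (hcard 0 hn)
      obtain ⟨v, -⟩ := Finset.card_pos.1 hpos
      refine ⟨fun _ => v, B, by simp, by simp, fun j _ hj => ⟨subset_rfl, ?_, by simp⟩⟩
      exact (Nat.mul_le_mul_left _ (Nat.pow_le_pow_right (by omega) (min_le_right _ _))).trans
        (hcard j hj)
    | succ r ih =>
      intro hr
      obtain ⟨y, S, hy, hred, hS⟩ := ih (by omega)
      let bad : ℕ → Finset V := fun j =>
        (S r).filter fun v => ((S j).filter (red.Adj v)).card < K * m * (2 * m) ^ (j - r - 1)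
      -- The red neighbourhoods of `m` bad vertices cover at most half of `S j`; what they miss
      -- contains `m` vertices joined to all of them in blue, contrary to `hno`.
      have hbad : ∀ j, r < j → j < n → j ≤ r + K → (bad j).card ≤ m - 1 := by
        intro j hrj hjn hjK
        by_contra hlt
        obtain ⟨X, hX, hXm⟩ := Finset.exists_subset_card_eq (show m ≤ (bad j).card by omega)
        obtain ⟨e, he⟩ : ∃ e, j - r = e + 1 := ⟨j - r - 1, by omega⟩
        have hSj := (hS j (by omega) hjn).2.1
        rw [min_eq_left (by omega), he] at hSj
        have hun : (X.biUnion fun x => (S j).filter (red.Adj x)).card ≤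
            m * (K * m * (2 * m) ^ e) := by
          rw [← hXm]
          refine Finset.card_biUnion_le_card_mul _ _ _ fun x hx => ?_
          have := (Finset.mem_filter.1 (hX hx)).2
          rw [he, Nat.add_sub_cancel, hXm.symm] at this
          exact this.le
        have hY : m ≤ (S j \ X.biUnion fun x => (S j).filter (red.Adj x)).card := by
          have h1 := Finset.le_card_sdiff (X.biUnion fun x => (S j).filter (red.Adj x)) (S j)
          have h2 : m ≤ m * (K * m * (2 * m) ^ e) := Nat.le_mul_of_pos_right _ (by positivity)
          have h3 : K * m * (2 * m) ^ (e + 1) = 2 * (m * (K * m * (2 * m) ^ e)) := by ring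
          omega
        obtain ⟨Y, hYs, hYm⟩ := Finset.exists_subset_card_eq hY
        have hXB : X ⊆ B r := fun x hx =>
          (hS r le_rfl (by omega)).1 (Finset.mem_filter.1 (hX hx)).1
        have hYS : Y ⊆ S j := fun x hx => (Finset.mem_sdiff.1 (hYs hx)).1
        have hYB : Y ⊆ B j := hYS.trans (hS j (by omega) hjn).1
        obtain ⟨x, hx, z, hz, hxz⟩ := hno r j hrj hjn hjK X hXB Y hYB hXm hYm
        have hredxz := (hcov r j hrj hjn hjK x (hXB hx) z (hYB hz)).resolve_right hxz
        exact (Finset.mem_sdiff.1 (hYs hz)).2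
          (Finset.mem_biUnion.2 ⟨x, hx, Finset.mem_filter.2 ⟨hYS hz, hredxz⟩⟩)
      -- At most `K` later positions matter, and each spoils at most `m - 1` of the at least `K * m`
      -- candidates.
      obtain ⟨v, hvS, hv⟩ : ∃ v ∈ S r, ∀ j, r < j → j < n → j ≤ r + K → v ∉ bad j := by
        by_contra! hcon
        have hsub : S r ⊆ ((Finset.Ioc r (r + K)).filter (· < n)).biUnion bad := by
          intro v hv
          obtain ⟨j, h1, h2, h3, h4⟩ := hcon v hv
          exact Finset.mem_biUnion.2 ⟨j, by simp; omega, h4⟩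
        have h1 := (Finset.card_le_card hsub).trans
          (Finset.card_biUnion_le_card_mul _ _ (m - 1) fun j hj => by
            simp only [Finset.mem_filter, Finset.mem_Ioc] at hj
            exact hbad j hj.1.1 hj.2 hj.1.2)
        have h2 : ((Finset.Ioc r (r + K)).filter (· < n)).card ≤ K :=
          (Finset.card_filter_le _ _).trans (by simp)
        have h3 := (hS r le_rfl (by omega)).2.1
        rw [Nat.sub_self, Nat.zero_min, pow_zero, mul_one] at h3
        have h4 := Nat.mul_le_mul_right (m - 1) h2
        have h5 : K * (m - 1) < K * m := Nat.mul_lt_mul_of_pos_left (by omega) hK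
        omega
      refine ⟨Function.update y r v, fun j => if j ≤ r + K then (S j).filter (red.Adj v) else S j,
        fun i hi => ?_, fun i j hij hj hjK => ?_, fun j hrj hjn => ⟨?_, ?_, fun i hi hjK w hw => ?_⟩⟩
      · rcases eq_or_ne i r with rfl | hne
        · rw [Function.update_self]
          exact (hS i le_rfl (by omega)).1 hvS
        · rw [Function.update_of_ne hne]
          exact hy i (by omega)
      · rw [Function.update_of_ne (show i ≠ r by omega)]
        rcases eq_or_ne j r with rfl | hne
        · rw [Function.update_self]
          exact (hS j le_rfl (by omega)).2.2 i hij hjK v hvS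
        · rw [Function.update_of_ne hne]
          exact hred i j hij (by omega) hjK
      · have := (hS j (by omega) hjn).1
        dsimp only
        split_ifs
        · exact (Finset.filter_subset _ _).trans this
        · exact this
      · dsimp only
        split_ifs with hjK
        · have := hv j (by omega) hjn hjK
          rw [Finset.mem_filter, not_and, not_lt] at this
          rw [min_eq_left (by omega)]
          exact this hvS
        · have := (hS j (by omega) hjn).2.1
          rw [min_eq_right (by omega)] at this ⊢
          exact this
      · have hSj := (hS j (by omega) hjn).2.2
        dsimp only at hw
        rcases eq_or_ne i r with rfl | hne
        · rw [Function.update_self]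
          rw [if_pos hjK] at hw
          exact (Finset.mem_filter.1 hw).2
        · rw [Function.update_of_ne hne]
          refine hSj i (by omega) hjK w ?_
          split_ifs at hw
          · exact (Finset.mem_filter.1 hw).1
          · exact hw
  obtain ⟨y, -, hy, hred, -⟩ := main n le_rfl
  refine ⟨y, fun i hi j hj hij => ?_, hred⟩
  by_contra hne
  exact Finset.disjoint_left.1 (hdisj i hi j hj hne) (hy i hi) (hij ▸ hy j hj)

/-- Along a sequence of disjoint cliques `B i`, consecutive ones spanning a `K_{2K,2K}`, there is
the `K`-th power of a path. -/
lemma exists_pathPower_of_cliques {V : Type*} {H : SimpleGraph V} {K n : ℕ} (hK : 0 < K)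
    {B : ℕ → Finset V} (hdisj : ∀ i ≤ n, ∀ j ≤ n, i ≠ j → Disjoint (B i) (B j))
    (hclique : ∀ i ≤ n, ∀ x ∈ B i, ∀ y ∈ B i, x ≠ y → H.Adj x y)
    (hlink : ∀ i ≤ n, ∃ X ⊆ B i, ∃ Y ⊆ B (i + 1), X.card = 2 * K ∧ Y.card = 2 * K ∧
      ∀ x ∈ X, ∀ y ∈ Y, H.Adj x y) :
    ∃ y, IsPathPower H K n y := by
  classical
  choose! X hXB Y hYB hX hY hXY using hlink
  have hX' : ∀ i ≤ n, ∃ X' ⊆ X i, X'.card = K := fun i hi =>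
    Finset.exists_subset_card_eq (by rw [hX i hi]; omega)
  choose! X' hX'X hX'c using hX'
  -- Sides of size `2 * K` leave `K` vertices of `Y i` after removing `X' (i + 1)`, which lies in
  -- the same clique.
  have hY' : ∀ i < n, ∃ Y' ⊆ Y i \ X' (i + 1), Y'.card = K := fun i hi =>
    Finset.exists_subset_card_eq (by
      have h1 := Finset.le_card_sdiff (X' (i + 1)) (Y i)
      rw [hY i hi.le, hX'c (i + 1) hi] at h1
      omega)
  choose! Y' hY'Y hY'c using hY'
  -- Blocks alternate `X' 0, Y' 0, X' 1, Y' 1, …`: `X' i` meets `Y' i` through the biclique and `Y'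
  -- i` meets `X' (i + 1)` inside `B (i + 1)`. Blocks have size `K`, so positions at most `K` apart
  -- lie in the same or consecutive blocks.
  let Q : ℕ → Finset V := fun b => if b % 2 = 0 then X' (b / 2) else Y' (b / 2)
  have hQB : ∀ b < n, Q b ⊆ B ((b + 1) / 2) := by
    intro b hb
    simp only [Q]
    split_ifs with h
    · rw [show (b + 1) / 2 = b / 2 by omega]
      exact (hX'X _ (by omega)).trans (hXB _ (by omega))
    · rw [show (b + 1) / 2 = b / 2 + 1 by omega]
      exact ((hY'Y _ (by omega)).trans Finset.sdiff_subset).trans (hYB _ (by omega))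
  have hQc : ∀ b < n, (Q b).card = K := by
    intro b hb
    simp only [Q]
    split_ifs
    · exact hX'c _ (by omega)
    · exact hY'c _ (by omega)
  have hnext : ∀ b, b + 1 < n → Disjoint (Q b) (Q (b + 1)) ∧
      ∀ x ∈ Q b, ∀ y ∈ Q (b + 1), H.Adj x y := by
    intro b hb
    rcases Nat.mod_two_eq_zero_or_one b with h | h
    · have hadj : ∀ x ∈ Q b, ∀ y ∈ Q (b + 1), H.Adj x y := by
        intro x hx y hy
        simp only [Q, h, if_true, show (b + 1) % 2 ≠ 0 by omega, if_false,
          show (b + 1) / 2 = b / 2 by omega] at hx hy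
        exact hXY _ (by omega) x (hX'X _ (by omega) hx) y
          (Finset.mem_sdiff.1 (hY'Y _ (by omega) hy)).1
      exact ⟨Finset.disjoint_left.2 fun x hx hx' => H.irrefl (hadj x hx x hx'), hadj⟩
    · have hd : Disjoint (Q b) (Q (b + 1)) := by
        simp only [Q, h, show (b + 1) % 2 = 0 by omega, if_true, one_ne_zero, if_false,
          show (b + 1) / 2 = b / 2 + 1 by omega]
        exact Finset.disjoint_of_subset_left (hY'Y _ (by omega)) Finset.sdiff_disjoint
      refine ⟨hd, fun x hx y hy => ?_⟩
      have hy' := hQB _ hb hy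
      rw [show (b + 1 + 1) / 2 = (b + 1) / 2 by omega] at hy'
      exact hclique _ (by omega) x (hQB b (by omega) hx) y hy'
        fun h => Finset.disjoint_left.1 hd hx (h ▸ hy)
  have hQdisj : ∀ b c, b < c → c < n → Disjoint (Q b) (Q c) := by
    intro b c hbc hc
    by_cases h : (b + 1) / 2 = (c + 1) / 2
    · obtain rfl : c = b + 1 := by omega
      exact (hnext b hc).1
    · exact (hdisj _ (by omega) _ (by omega) h).mono (hQB b (by omega)) (hQB c hc)
  have he : ∀ b < n, ∃ e : ℕ → V, (∀ i < K, e i ∈ Q b) ∧ ∀ i < K, ∀ j < K, e i = e j → i = j := by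
    intro b hb
    let φ := (Q b).equivFinOfCardEq (hQc b hb)
    refine ⟨fun i => if h : i < K then φ.symm ⟨i, h⟩ else φ.symm ⟨0, hK⟩, fun i hi => ?_,
      fun i hi j hj hij => ?_⟩
    · simp [hi]
    · simpa [hi, hj, Subtype.ext_iff] using hij
  have hblock : ∀ i < n, i / K < n := fun i hi => (Nat.div_le_self _ _).trans_lt hi
  rcases (isEmpty_or_nonempty V).symm with hV | hV
  · choose! e heQ heinj using he
    have hmod : ∀ i, i % K < K := fun i => Nat.mod_lt _ hK
    have hinj : ∀ i < n, ∀ j < n, e (i / K) (i % K) = e (j / K) (j % K) → i = j := by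
      intro i hi j hj hij
      have h1 := heQ _ (hblock i hi) _ (hmod i)
      have h2 := heQ _ (hblock j hj) _ (hmod j)
      have hb : i / K = j / K := by
        rcases lt_trichotomy (i / K) (j / K) with h | h | h
        · exact absurd h2 (Finset.disjoint_left.1 (hQdisj _ _ h (hblock j hj)) (hij ▸ h1))
        · exact h
        · exact absurd h1 (Finset.disjoint_left.1 (hQdisj _ _ h (hblock i hi)) (hij ▸ h2))
      rw [hb] at hij
      have hr := heinj _ (hblock j hj) _ (hmod i) _ (hmod j) hij
      rw [← Nat.div_add_mod i K, ← Nat.div_add_mod j K, hb, hr]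
    refine ⟨fun i => e (i / K) (i % K), fun i hi j hj => hinj i hi j hj, fun i j hij hj hjK => ?_⟩
    change H.Adj (e (i / K) (i % K)) (e (j / K) (j % K))
    have h1 := heQ _ (hblock i (by omega)) _ (hmod i)
    have h2 := heQ _ (hblock j hj) _ (hmod j)
    have hle : i / K ≤ j / K := Nat.div_le_div_right hij.le
    have hle' : j / K ≤ i / K + 1 := by
      rw [← Nat.add_div_right i hK]; exact Nat.div_le_div_right hjK
    rcases (by omega : j / K = i / K ∨ j / K = i / K + 1) with h | h
    · have hb := hblock i (by omega)
      rw [h] at h2 ⊢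
      refine hclique _ (by omega) _ (hQB _ hb h1) _ (hQB _ hb h2) fun heq => ?_
      exact hij.ne (hinj i (by omega) j hj (by rw [h]; exact heq))
    · have hb := hblock j hj
      rw [h] at hb h2 ⊢
      exact (hnext _ hb).2 _ h1 _ h2
  · rcases Nat.eq_zero_or_pos n with rfl | hn
    · obtain ⟨x, -⟩ := Finset.card_pos.1 (by rw [hX 0 le_rfl]; omega : 0 < (X 0).card)
      exact (hV.false x).elim
    · obtain ⟨e, he, -⟩ := he 0 hn
      exact (hV.false (e 0)).elim

lemma edist_getElem_le {α : Type*} {G : SimpleGraph α} {P : List α} (h : P.IsChain G.Adj)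
    (i d : ℕ) (hd : i + d < P.length) : G.edist P[i] P[i + d] ≤ d := by
  induction d with
  | zero => simp
  | succ d ih =>
    have hadj := List.isChain_iff_getElem.1 h (i + d) hd
    refine (SimpleGraph.edist_triangle (v := P[i + d])).trans ?_
    have h1 := SimpleGraph.edist_eq_one_iff_adj.2 hadj
    push_cast
    exact add_le_add (ih (by omega)) h1.le

/-! ### The colour dichotomy and the conclusion -/

/-- Let `G` be an expander on `A` whose vertices `u` carry disjoint blue cliques `B u`, with all
edges red or blue between cliques at distance at most `K`. Then there is a monochromatic `K`-th
power of a path. -/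
lemma exists_pathPower_of_expander {α V : Type*} {G : SimpleGraph α} {A : Finset α} {K n : ℕ}
    (hK : 0 < K) (hn : 0 < n) (hA : 2 ^ K * (5 * n) ≤ A.card)
    (hexp : ∀ X Y : Finset α, X ⊆ A → Y ⊆ A → Disjoint X Y → n ≤ X.card → n ≤ Y.card →
      ∃ x ∈ X, ∃ y ∈ Y, G.Adj x y)
    {red blue : SimpleGraph V} {B : α → Finset V}
    (hdisj : ∀ u v, u ≠ v → Disjoint (B u) (B v))
    (hcard : ∀ u, K * (2 * K) * (2 * (2 * K)) ^ K ≤ (B u).card)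
    (hblue : ∀ u ∈ A, ∀ x ∈ B u, ∀ y ∈ B u, x ≠ y → blue.Adj x y)
    (hcov : ∀ u v, u ≠ v → G.edist u v ≤ K → ∀ x ∈ B u, ∀ y ∈ B v, red.Adj x y ∨ blue.Adj x y) :
    (∃ y, IsPathPower blue K n y) ∨ ∃ y, IsPathPower red K n y := by
  classical
  let R : α → α → Prop := fun u v => ∃ X ⊆ B u, ∃ Y ⊆ B v, X.card = 2 * K ∧ Y.card = 2 * K ∧
    ∀ x ∈ X, ∀ y ∈ Y, blue.Adj x y
  have hRsymm : ∀ u v, R u v → R v u := fun u v ⟨X, hX, Y, hY, hXc, hYc, h⟩ =>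
    ⟨Y, hY, X, hX, hYc, hXc, fun y hy x hx => (h x hx y hy).symm⟩
  have hget : ∀ (P : List α) (i : ℕ) (hi : i < P.length), ((P[i]?).elim ∅ B) = B P[i] := by
    intro P i hi; simp [hi]
  -- Stringing cliques needs `B 0, …, B (n + 1)`, hence the threshold `n + 1`.
  by_cases hpath : ∀ P : List α, P.Nodup → P.IsChain R → (∀ x ∈ P, x ∈ A) → P.length ≤ n + 1
  · right
    -- The size `3 * n` is `2 * M + l` for `M = l = n` in `exists_cyclic_path`.
    obtain ⟨W, hW, hsep⟩ := exists_separated_sets hRsymm hpath (3 * n) K (by nlinarith)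
    have hKp : K + 1 ≤ 2 ^ K := Nat.lt_two_pow_self
    have hsub : (Finset.range (K + 1)).biUnion W ⊆ A := Finset.biUnion_subset.2 fun i hi =>
      (hW i ((Finset.mem_range.1 hi).trans_le hKp)).1
    obtain ⟨P, i₀, hnd, hlen, hch, hPW⟩ := exists_cyclic_path (G := G.Adj) (M := n) (l := n)
      (p := K + 1) (W := W) (by omega)
      (fun X Y hX hY => hexp X Y (hX.trans hsub) (hY.trans hsub))
      (fun i hi => le_trans (by omega) (hW i (by omega)).2)
      (fun i hi j hj hij => (hsep i (by omega) j (by omega) hij).1)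
    refine exists_pathPower_of_no_biclique (red := red) (blue := blue) (m := 2 * K) hK (by omega) hn
      (B := fun i => (P[i]?).elim ∅ B) ?_ ?_ ?_ ?_
    · intro i hi j hj hij
      rw [hget P i (by omega), hget P j (by omega)]
      exact hdisj _ _ fun h => hij ((hnd.getElem_inj_iff).1 h)
    · intro j hj
      rw [hget P j (by omega)]
      exact hcard _
    · intro i j hij hj hjK
      rw [hget P i (by omega), hget P j (by omega)]
      refine hcov _ _ (fun h => hij.ne ((hnd.getElem_inj_iff).1 h)) ?_
      obtain ⟨d, rfl⟩ := Nat.exists_eq_add_of_lt hij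
      refine (edist_getElem_le hch i (d + 1) (by omega)).trans ?_
      exact_mod_cast (by omega : d + 1 ≤ K)
    · intro i j hij hj hjK X hX Y hY hXc hYc
      rw [hget P i (by omega)] at hX
      rw [hget P j (by omega)] at hY
      by_contra! hcon
      -- Positions differing by at most `K` are distinct modulo `K + 1`, so they visit different,
      -- hence unrelated, classes.
      have hne : (i₀ + i) % (K + 1) ≠ (i₀ + j) % (K + 1) := by
        intro h
        have h' : i₀ + i ≡ i₀ + j [MOD K + 1] := h
        have h'' := (Nat.modEq_iff_dvd' (by omega)).1 h'
        have := Nat.le_of_dvd (by omega) h''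
        omega
      have hm : ∀ a, a % (K + 1) < 2 ^ K := fun a => (Nat.mod_lt _ (by omega)).trans_le hKp
      exact (hsep _ (hm _) _ (hm _) hne).2 _ (hPW i (by omega)) _ (hPW j (by omega))
        ⟨X, hX, Y, hY, hXc, hYc, hcon⟩
  · left
    push Not at hpath
    obtain ⟨P, hnd, hch, hPA, hlen⟩ := hpath
    refine exists_pathPower_of_cliques hK (B := fun i => (P[i]?).elim ∅ B) ?_ ?_ ?_
    · intro i hi j hj hij
      rw [hget P i (by omega), hget P j (by omega)]
      exact hdisj _ _ fun h => hij ((hnd.getElem_inj_iff).1 h)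
    · intro i hi
      rw [hget P i (by omega)]
      exact hblue _ (hPA _ (List.getElem_mem _))
    · intro i hi
      rw [hget P i (by omega), hget P (i + 1) (by omega)]
      exact List.isChain_iff_getElem.1 hch i (by omega)

/-- A blow-up of a power of an expander arrows the power of a cycle. -/
lemma blowup_arrows {k n t : ℕ} (hk : 0 < k) (hn : 0 < n) {α : Type} {G : SimpleGraph α}
    {A : Finset α} (hA : 2 * (2 ^ (2 * k) * (5 * n)) ≤ A.card)
    (hexp : ∀ X Y : Finset α, X ⊆ A → Y ⊆ A → Disjoint X Y → n ≤ X.card → n ≤ Y.card →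
      ∃ x ∈ X, ∃ y ∈ Y, G.Adj x y)
    (ht : ∀ {V : Type} (R₀ R₁ : SimpleGraph V)
      (T : Finset V), t ≤ T.card → (∀ x ∈ T, ∀ y ∈ T, x ≠ y → R₀.Adj x y ∨ R₁.Adj x y) →
      (∃ S ⊆ T, S.card = 2 * k * (2 * (2 * k)) * (2 * (2 * (2 * k))) ^ (2 * k) ∧
        ∀ x ∈ S, ∀ y ∈ S, x ≠ y → R₀.Adj x y) ∨
      (∃ S ⊆ T, S.card = 2 * k * (2 * (2 * k)) * (2 * (2 * (2 * k))) ^ (2 * k) ∧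
        ∀ x ∈ S, ∀ y ∈ S, x ≠ y → R₁.Adj x y)) :
    Arrows (blowup G (2 * k) t) (power (SimpleGraph.cycleGraph n) k) 2 := by
  classical
  intro c
  have hcov : ∀ x y, (blowup G (2 * k) t).Adj x y →
      (c.labelGraph 0).Adj x y ∨ (c.labelGraph 1).Adj x y := by
    intro x y h
    simp only [SimpleGraph.EdgeLabeling.labelGraph_adj]
    rcases Fin.exists_fin_two.1 ⟨c ⟨s(x, y), h⟩, rfl⟩ with h' | h'
    · exact Or.inl ⟨h, h'⟩
    · exact Or.inr ⟨h, h'⟩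
  have hmono : ∀ u : α, ∃ (i : Fin 2) (S : Finset (α × Fin t)), (∀ x ∈ S, x.1 = u) ∧
      S.card = 2 * k * (2 * (2 * k)) * (2 * (2 * (2 * k))) ^ (2 * k) ∧
        ∀ x ∈ S, ∀ y ∈ S, x ≠ y → (c.labelGraph i).Adj x y := by
    intro u
    have hfst : ∀ x ∈ ({u} : Finset α) ×ˢ (Finset.univ : Finset (Fin t)), x.1 = u := by simp
    rcases ht (c.labelGraph 0) (c.labelGraph 1) (({u} : Finset α) ×ˢ Finset.univ) (by simp)
      (fun x hx y hy hxy => hcov x y ⟨hxy, by simp [hfst x hx, hfst y hy]⟩) with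
      ⟨S, hS, hc, h⟩ | ⟨S, hS, hc, h⟩
    · exact ⟨0, S, fun x hx => hfst x (hS hx), hc, h⟩
    · exact ⟨1, S, fun x hx => hfst x (hS hx), hc, h⟩
  choose col B hBfst hBcard hBmono using hmono
  have hBdisj : ∀ u v, u ≠ v → Disjoint (B u) (B v) := fun u v huv =>
    Finset.disjoint_left.2 fun x hx hx' => huv ((hBfst u x hx).symm.trans (hBfst v x hx'))
  -- The majority colour `i` plays blue and the other colour `j` plays red.
  have finish : ∀ i j : Fin 2, 2 ^ (2 * k) * (5 * n) ≤ (A.filter (col · = i)).card →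
      (∀ x y, (blowup G (2 * k) t).Adj x y →
        (c.labelGraph j).Adj x y ∨ (c.labelGraph i).Adj x y) →
      ∃ i : Fin 2, (power (SimpleGraph.cycleGraph n) k).IsContained (c.labelGraph i) := by
    intro i j hi hij
    have hsub : A.filter (col · = i) ⊆ A := Finset.filter_subset _ _
    rcases exists_pathPower_of_expander (G := G) (A := A.filter (col · = i)) (K := 2 * k) (n := n)
      (red := c.labelGraph j) (blue := c.labelGraph i) (B := B) (by omega) hn hi
      (fun X Y hX hY => hexp X Y (hX.trans hsub) (hY.trans hsub)) hBdisj
      (fun u => (hBcard u).ge)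
      (fun u hu => (Finset.mem_filter.1 hu).2 ▸ hBmono u)
      (fun u v huv hd x hx y hy => hij x y ⟨fun h => Finset.disjoint_left.1 (hBdisj u v huv) hx
        (h ▸ hy), by rw [hBfst u x hx, hBfst v y hy]; exact_mod_cast hd⟩) with ⟨y, hy⟩ | ⟨y, hy⟩
    · exact ⟨i, hy.cyclePower_isContained⟩
    · exact ⟨j, hy.cyclePower_isContained⟩
  have hsplit : A.card = (A.filter (col · = 0)).card + (A.filter (col · = 1)).card := by
    rw [← Finset.card_filter_add_card_filter_not (s := A) (col · = 0)]
    congr 2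
    ext u
    simp only [Finset.mem_filter]
    refine and_congr_right fun _ => ?_
    rw [← ne_eq, Fin.ne_iff_vne, Fin.ext_iff]
    have := (col u).2
    simp only [Fin.val_zero, Fin.val_one]
    omega
  rcases (by omega : 2 ^ (2 * k) * (5 * n) ≤ (A.filter (col · = 0)).card ∨
      2 ^ (2 * k) * (5 * n) ≤ (A.filter (col · = 1)).card) with h | h
  · exact finish 0 1 h fun x y hxy => (hcov x y hxy).symm
  · exact finish 1 0 h hcov

end SizeRamsey

/-- For every fixed `k ≥ 2`, the size-Ramsey number of the `k`-th power of the `n`-vertex cycle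
is `O(n)` as `n → ∞`, the implied constant depending only on `k`. -/
theorem corollary1p2 (k : ℕ) (hk : 2 ≤ k) :
    ∃ C : ℕ, ∀ᶠ n : ℕ in Filter.atTop,
      SizeRamsey.sizeRamsey (SizeRamsey.power (SimpleGraph.cycleGraph n) k) ≤ (C : ℕ∞) * n := by
  obtain ⟨t, ht⟩ := SizeRamsey.exists_ramsey_number
    (2 * k * (2 * (2 * k)) * (2 * (2 * (2 * k))) ^ (2 * k))
    (2 * k * (2 * (2 * k)) * (2 * (2 * (2 * k))) ^ (2 * k))
  -- `20 = 2 * 2 * 5`: one factor `2` for passing to `A`, one for the majority colour, and `2 ^ K *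
  -- (5 * n)` vertices needed in the dichotomy.
  obtain ⟨b, hb⟩ := SizeRamsey.exists_expander (20 * 2 ^ (2 * k))
    (by have := Nat.one_le_two_pow (n := 2 * k); omega)
  refine ⟨(b + 1) ^ (2 * k) * t * t * (20 * 2 ^ (2 * k)), ?_⟩
  filter_upwards [Filter.eventually_gt_atTop 0] with n hn
  obtain ⟨G, A, hA, hdeg, hexp⟩ := hb n hn
  refine (SizeRamsey.sizeRamsey_le_of_arrows
    (SizeRamsey.blowup_arrows (by omega) hn (by nlinarith) hexp ht)).trans ?_
  refine (SizeRamsey.encard_edgeSet_blowup_le G hdeg (2 * k) t).trans ?_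
  rw [Fintype.card_fin, ← mul_assoc]
  push_cast
  exact le_rfl
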